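/- Let $x_{\max}>0$, $\varepsilon>0$, $\alpha>0$ and $\Omega=(-x_{\max},x_{\max})\times(-1,1)$, with points $(x,v)$. Put $$\Gamma^-=\{-x_{\max}\}\times[0,1)\,\cup\,\{x_{\max}\}\times(-1,0],\qquad \Gamma^+=\{-x_{\max}\}\times(-1,0)\,\cup\,\{x_{\max}\}\times(0,1),$$ $\Gamma_0=(-x_{\max},x_{\max})\times\{\pm1\}$ and $\Gamma_0^\pm=\Gamma^\pm\cup\Gamma_0$. Let $M=\begin{pmatrix}M_{11}&M_{12}\\M_{12}&M_{22}\end{pmatrix}$ be a real symmetric, positive semidefinite matrix with non-negative entries such that $4\varepsilon M_{12}>M_{22}^2$, and let $N=\begin{pmatrix}M_{12}&M_{22}/2\\M_{22}/2&\varepsilon\end{pmatrix}$. Write $(\cdot,\cdot)$ for the $L^2(\Omega)$ inner product, and for $w,\phi\in H^1(\Omega)$ put $$\mathcal Hw=\begin{pmatrix}w\\\sqrt M\,\nabla w\end{pmatrix},\qquad (w,\phi)_{\mathcal H}=(\mathcal Hw,\mathcal H\phi)=(w,\phi)+(\nabla w,M\nabla\phi),\qquad \|w\|_{\mathcal H}^2=(w,w)_{\mathcal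 H}.$$ Let $H^2_{0,\Gamma_0^\pm}(\Omega)=\{w\in H^2(\Omega):\mathcal Hw=0\text{ on }\Gamma_0^\pm\text{ in the sense of traces}\}$, and define $$a(w,\phi)=(vw_x,\phi)_{\mathcal H}+\varepsilon(w_v,\phi_v)_{\mathcal H},$$ $$a^*(z,\psi)=-(v\mathcal Hz_x,\mathcal H\psi)+(M_{12}z_x+M_{22}z_v,\psi_x)+\varepsilon(z_v,\psi_v)+\varepsilon(\nabla z_v,M\nabla\psi_v).$$ Let $C_p$ be the Poincaré constant of $\Omega$, that is, the smallest $C\ge0$ such that $\|w\|_{L^2(\Omega)}\le C\|\nabla w\|_{L^2(\Omega)}$ for all $w\in H^1(\Omega)$ that vanish on $\Gamma_0^-$ or on $\Gamma_0^+$. Let $\lambda_-$ and $\lambda_+$ denote the smallest and the largest eigenvalue, and let $$\delta=\frac{\lambda_-(N)}{\max\{1,\lambda_+(M)\}\,(1+C_p^2)}.$$ Let $\mathcal D\in H^1(\Omega)$, and let $(u,z,f)\in H^2_{0,\Gamma_0^-}(\Omega)\times H^2_{0,\Gamma_0^+}(\Omega)\times H^1(\Omega)$ solve the stationary KKT system $$a(u,\phi)=(f,\phi)_{\mathcal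 H},\qquad a^*(z,\psi)=(\mathcal D-u,\psi)_{\mathcal H},\qquad(\alpha f-z,\xi)_{\mathcal H}=0$$ for all $(\phi,\psi,\xi)\in H^2_{0,\Gamma_0^-}(\Omega)\times H^2_{0,\Gamma_0^+}(\Omega)\times H^1(\Omega)$. Then $\delta>0$ and $$\delta\Big(\|u\|_{\mathcal H}^2+\frac\alpha2\|f\|_{\mathcal H}^2\Big)\le\frac1{2\alpha\delta}\|\mathcal D\|_{\mathcal H}^2 .$$ -/

import Mathlib

open MeasureTheory Filter Topology
open scoped ContDiff

noncomputable section

namespace Kolmogorov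

/-! Points of the phase space are pairs `p = (x, v)`: `p.1` is the position and `p.2` the velocity. -/

/-- The position-velocity domain `Ω = (-xmax, xmax) × (-1, 1)`. -/
def Omega (xmax : ℝ) : Set (ℝ × ℝ) :=
  Set.Ioo (-xmax) xmax ×ˢ Set.Ioo (-1 : ℝ) 1

/-- The inflow boundary `Γ⁻`. -/
def inflow (xmax : ℝ) : Set (ℝ × ℝ) :=
  {-xmax} ×ˢ Set.Ico (0 : ℝ) 1 ∪ {xmax} ×ˢ Set.Ioc (-1 : ℝ) 0

/-- The outflow boundary `Γ⁺`. -/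
def outflow (xmax : ℝ) : Set (ℝ × ℝ) :=
  {-xmax} ×ˢ Set.Ioo (-1 : ℝ) 0 ∪ {xmax} ×ˢ Set.Ioo (0 : ℝ) 1

/-- The parabolic boundary `Γ₀`. -/
def parabolic (xmax : ℝ) : Set (ℝ × ℝ) :=
  Set.Ioo (-xmax) xmax ×ˢ {1, -1}

/-- `Γ₀⁻ = Γ⁻ ∪ Γ₀`. -/
def gammaMinus (xmax : ℝ) : Set (ℝ × ℝ) := inflow xmax ∪ parabolic xmax

/-- `Γ₀⁺ = Γ⁺ ∪ Γ₀`. -/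
def gammaPlus (xmax : ℝ) : Set (ℝ × ℝ) := outflow xmax ∪ parabolic xmax

/-- Lebesgue measure on `Ω`. -/
def vol (xmax : ℝ) : Measure (ℝ × ℝ) := volume.restrict (Omega xmax)

/-- Arc length on `∂Ω`, as the sum of the length measures of the four open sides of the
rectangle. -/
def arcLength (xmax : ℝ) : Measure (ℝ × ℝ) :=
  Measure.map (fun v : ℝ => (-xmax, v)) (volume.restrict (Set.Ioo (-1) 1)) +
  Measure.map (fun v : ℝ => (xmax, v)) (volume.restrict (Set.Ioo (-1) 1)) +
  Measure.map (fun x : ℝ => (x, -1)) (volume.restrict (Set.Ioo (-xmax) xmax)) +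
  Measure.map (fun x : ℝ => (x, 1)) (volume.restrict (Set.Ioo (-xmax) xmax))

/-! ### Sobolev spaces through weak derivatives -/

/-- `g` is a weak derivative of `w` on `Ω` in the direction `e`. -/
def IsWeakDeriv (xmax : ℝ) (e : ℝ × ℝ) (w g : ℝ × ℝ → ℝ) : Prop :=
  LocallyIntegrableOn w (Omega xmax) ∧ LocallyIntegrableOn g (Omega xmax) ∧
    ∀ φ : ℝ × ℝ → ℝ, ContDiff ℝ ∞ φ → HasCompactSupport φ → tsupport φ ⊆ Omega xmax →
      ∫ p, w p * fderiv ℝ φ p e ∂(vol xmax) = -∫ p, g p * φ p ∂(vol xmax)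

open Classical in
/-- The weak derivative of `w` on `Ω` in the direction `e`. It is determined almost everywhere on
`Ω`; the value is `0` if there is no weak derivative. -/
def weakDeriv (xmax : ℝ) (e : ℝ × ℝ) (w : ℝ × ℝ → ℝ) : ℝ × ℝ → ℝ :=
  if h : ∃ g, IsWeakDeriv xmax e w g then h.choose else 0

/-- The weak derivative `w_x`. -/
def Dx (xmax : ℝ) (w : ℝ × ℝ → ℝ) : ℝ × ℝ → ℝ := weakDeriv xmax (1, 0) w

/-- The weak derivative `w_v`. -/
def Dv (xmax : ℝ) (w : ℝ × ℝ → ℝ) : ℝ × ℝ → ℝ := weakDeriv xmax (0, 1) w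

/-- `w ∈ H¹(Ω)`. -/
def MemH1 (xmax : ℝ) (w : ℝ × ℝ → ℝ) : Prop :=
  MemLp w 2 (vol xmax) ∧
    (∃ g, IsWeakDeriv xmax (1, 0) w g ∧ MemLp g 2 (vol xmax)) ∧
    (∃ g, IsWeakDeriv xmax (0, 1) w g ∧ MemLp g 2 (vol xmax))

/-- `w ∈ H²(Ω)`. -/
def MemH2 (xmax : ℝ) (w : ℝ × ℝ → ℝ) : Prop :=
  MemH1 xmax w ∧ MemH1 xmax (Dx xmax w) ∧ MemH1 xmax (Dv xmax w)

/-- The function `w ∈ H¹(Ω)` has vanishing trace on `Γ ⊆ ∂Ω`. As the trace operator is the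
continuous extension to `H¹(Ω)` of the restriction of smooth functions to the boundary, this means
that functions smooth up to the boundary converge to `w` in `H¹(Ω)` while their restrictions to
`Γ` converge to `0` in `L²(Γ)`. -/
def ZeroTrace (xmax : ℝ) (Γ : Set (ℝ × ℝ)) (w : ℝ × ℝ → ℝ) : Prop :=
  ∃ φ : ℕ → ℝ × ℝ → ℝ, (∀ n, ContDiff ℝ ∞ (φ n)) ∧
    Tendsto (fun n => ∫ p, ((φ n p - w p) ^ 2 + (fderiv ℝ (φ n) p (1, 0) - Dx xmax w p) ^ 2 +
      (fderiv ℝ (φ n) p (0, 1) - Dv xmax w p) ^ 2) ∂(vol xmax)) atTop (𝓝 0) ∧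
    Tendsto (fun n => ∫ p, (φ n p) ^ 2 ∂((arcLength xmax).restrict Γ)) atTop (𝓝 0)

/-! ### The operator `𝓗` and the bilinear forms -/

/-- The `L²(Ω)` inner product. -/
def innerL2 (xmax : ℝ) (w φ : ℝ × ℝ → ℝ) : ℝ := ∫ p, w p * φ p ∂(vol xmax)

open scoped MatrixOrder in
/-- The positive semidefinite square root of a positive semidefinite matrix. -/
def sqrtMat (M : Matrix (Fin 2) (Fin 2) ℝ) : Matrix (Fin 2) (Fin 2) ℝ := CFC.sqrt M

/-- The three components of `𝓗w = (w, √M ∇w)`. -/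
def opH (xmax : ℝ) (M : Matrix (Fin 2) (Fin 2) ℝ) (w : ℝ × ℝ → ℝ) : Fin 3 → ℝ × ℝ → ℝ :=
  ![w,
    fun p => sqrtMat M 0 0 * Dx xmax w p + sqrtMat M 0 1 * Dv xmax w p,
    fun p => sqrtMat M 1 0 * Dx xmax w p + sqrtMat M 1 1 * Dv xmax w p]

/-- `(w, φ)_𝓗 = (𝓗w, 𝓗φ)`. -/
def innerH (xmax : ℝ) (M : Matrix (Fin 2) (Fin 2) ℝ) (w φ : ℝ × ℝ → ℝ) : ℝ :=
  ∑ i, innerL2 xmax (opH xmax M w i) (opH xmax M φ i)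

/-- `‖w‖_𝓗`. -/
def normH (xmax : ℝ) (M : Matrix (Fin 2) (Fin 2) ℝ) (w : ℝ × ℝ → ℝ) : ℝ :=
  Real.sqrt (innerH xmax M w w)

/-- The space `H²_{0,Γ}(Ω)` of all `w ∈ H²(Ω)` with `𝓗w = 0` on `Γ`. -/
def H2Zero (xmax : ℝ) (M : Matrix (Fin 2) (Fin 2) ℝ) (Γ : Set (ℝ × ℝ)) : Set (ℝ × ℝ → ℝ) :=
  {w | MemH2 xmax w ∧ ∀ i, ZeroTrace xmax Γ (opH xmax M w i)}

/-- The bilinear form `a(w, φ) = (v w_x, φ)_𝓗 + ε (w_v, φ_v)_𝓗`. -/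
def formA (xmax ε : ℝ) (M : Matrix (Fin 2) (Fin 2) ℝ) (w φ : ℝ × ℝ → ℝ) : ℝ :=
  innerH xmax M (fun p => p.2 * Dx xmax w p) φ + ε * innerH xmax M (Dv xmax w) (Dv xmax φ)

/-- The adjoint bilinear form
`a*(z, ψ) = -(v 𝓗z_x, 𝓗ψ) + (M₁₂ z_x + M₂₂ z_v, ψ_x) + ε (z_v, ψ_v) + ε (∇z_v, M ∇ψ_v)`;
the last two terms are `ε (z_v, ψ_v)_𝓗`. -/
def formAdj (xmax ε : ℝ) (M : Matrix (Fin 2) (Fin 2) ℝ) (z ψ : ℝ × ℝ → ℝ) : ℝ :=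
  -(∑ i, innerL2 xmax (fun p => p.2 * opH xmax M (Dx xmax z) i p) (opH xmax M ψ i)) +
    innerL2 xmax (fun p => M 0 1 * Dx xmax z p + M 1 1 * Dv xmax z p) (Dx xmax ψ) +
    ε * innerH xmax M (Dv xmax z) (Dv xmax ψ)

/-- `(u, z, f)` solves the stationary KKT system with target `D` and regularisation parameter
`α`. -/
structure SolvesKKT (xmax ε α : ℝ) (M : Matrix (Fin 2) (Fin 2) ℝ)
    (D u z f : ℝ × ℝ → ℝ) : Prop where
  mem_u : u ∈ H2Zero xmax M (gammaMinus xmax)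
  mem_z : z ∈ H2Zero xmax M (gammaPlus xmax)
  mem_f : MemH1 xmax f
  primal : ∀ φ ∈ H2Zero xmax M (gammaMinus xmax), formA xmax ε M u φ = innerH xmax M f φ
  adjoint : ∀ ψ ∈ H2Zero xmax M (gammaPlus xmax),
    formAdj xmax ε M z ψ = innerH xmax M (fun p => D p - u p) ψ
  control : ∀ ξ, MemH1 xmax ξ → innerH xmax M (fun p => α * f p - z p) ξ = 0

/-! ### The constant `δ` -/

/-- The smallest eigenvalue of a symmetric matrix. -/
def lambdaMin (A : Matrix (Fin 2) (Fin 2) ℝ) : ℝ := sInf (spectrum ℝ A)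

/-- The largest eigenvalue of a symmetric matrix. -/
def lambdaMax (A : Matrix (Fin 2) (Fin 2) ℝ) : ℝ := sSup (spectrum ℝ A)

/-- The matrix `N`. -/
def matN (ε : ℝ) (M : Matrix (Fin 2) (Fin 2) ℝ) : Matrix (Fin 2) (Fin 2) ℝ :=
  !![M 0 1, M 1 1 / 2; M 1 1 / 2, ε]

/-- The constant `C⁺_eq = max (1, λ₊(M))` of the norm equivalence. -/
def cEq (M : Matrix (Fin 2) (Fin 2) ℝ) : ℝ := max 1 (lambdaMax M)

/-- The Poincaré constant of `Ω`: the smallest `C ≥ 0` such that `‖w‖ ≤ C ‖∇w‖` in `L²(Ω)` for all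
`w ∈ H¹(Ω)` that vanish on `Γ₀⁻` or on `Γ₀⁺`. -/
def poincareConst (xmax : ℝ) : ℝ :=
  sInf {C : ℝ | 0 ≤ C ∧ ∀ w, MemH1 xmax w →
    (ZeroTrace xmax (gammaMinus xmax) w ∨ ZeroTrace xmax (gammaPlus xmax) w) →
    Real.sqrt (innerL2 xmax w w) ≤ C * Real.sqrt (innerL2 xmax (Dx xmax w) (Dx xmax w) +
      innerL2 xmax (Dv xmax w) (Dv xmax w))}

/-- `δ = (C⁺_eq)⁻¹ (1 + C_p²)⁻¹ λ₋(N)`. -/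
def delta (xmax ε : ℝ) (M : Matrix (Fin 2) (Fin 2) ℝ) : ℝ :=
  (cEq M)⁻¹ * (1 + poincareConst xmax ^ 2)⁻¹ * lambdaMin (matN ε M)

end Kolmogorov

end

noncomputable section

namespace Kolmogorov

/-! ### Weak derivatives in `L²` -/

/-! The estimate follows by testing each equation with its own solution. Both forms are coercive,
`δ‖w‖²_𝓗 ≤ a(w,w)` and `δ‖w‖²_𝓗 ≤ a*(w,w)`, on their respective spaces (`formA_coercive`,
`formAdj_coercive`). The control equation says that `z` acts as `αf` in `(·,·)_𝓗`, so `z` can be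
eliminated. Testing with `u` and `z` and adding makes the coupling terms `(f,u)_𝓗` cancel, leaving
`δ(‖u‖² + α‖f‖²) ≤ (f,D)_𝓗`; Young's inequality absorbs half of the control term.

Coercivity is hypocoercive: `ε‖w_v‖²` alone does not control `w_x`. Since `∂_v(v w_x) = v w_xv +
w_x`, the gradient part of `(·,·)_𝓗` produces the commutator `(M₁₂w_x + M₂₂w_v, w_x)`, which
together with `ε‖w_v‖²` is the quadratic form of `N` in `∇w` (`formA_self_eq`). As `N` is positive
definite, this bounds `‖∇w‖²`, and Poincaré's inequality bounds the full norm.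

The remaining transport terms `(v ∂ₓ𝓗w, 𝓗w)` are boundary fluxes whose sign is fixed by the
vanishing traces. Traces are given only through smooth approximations, so the flux and Poincaré
inequalities are first proved for smooth functions with an explicit boundary error and then passed
to the limit (`transport_of_zeroTrace`, `poincare_of_zeroTrace`). -/

lemma isOpen_Omega (X : ℝ) : IsOpen (Omega X) := isOpen_Ioo.prod isOpen_Ioo

lemma measurableSet_Omega (X : ℝ) : MeasurableSet (Omega X) := (isOpen_Omega X).measurableSet

lemma vol_eq_prod (X : ℝ) :
    vol X = (volume.restrict (Set.Ioo (-X) X)).prod (volume.restrict (Set.Ioo (-1 : ℝ) 1)) := by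
  rw [Measure.prod_restrict]; rfl

instance (X : ℝ) : IsFiniteMeasure (vol X) := by
  rw [vol_eq_prod]; infer_instance

lemma ae_mem_Omega (X : ℝ) : ∀ᵐ p ∂(vol X), p ∈ Omega X :=
  ae_restrict_mem (measurableSet_Omega X)

lemma ae_abs_snd_le (X : ℝ) : ∀ᵐ p ∂(vol X), |p.2| ≤ 1 := by
  filter_upwards [ae_mem_Omega X] with p hp
  exact abs_le.2 ⟨hp.2.1.le, hp.2.2.le⟩

/-- `w` and `g` are square integrable and `g` is the weak derivative of `w` in direction `e`. -/
structure IsL2Deriv (X : ℝ) (e : ℝ × ℝ) (w g : ℝ × ℝ → ℝ) : Prop where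
  memLp : MemLp w 2 (vol X)
  memLp_deriv : MemLp g 2 (vol X)
  integral_eq : ∀ φ : ℝ × ℝ → ℝ, ContDiff ℝ ∞ φ → HasCompactSupport φ → tsupport φ ⊆ Omega X →
      ∫ p, w p * fderiv ℝ φ p e ∂(vol X) = -∫ p, g p * φ p ∂(vol X)

variable {X : ℝ} {e : ℝ × ℝ} {w g w' g' φ : ℝ × ℝ → ℝ}

lemma _root_.MeasureTheory.MemLp.locallyIntegrableOn_Omega (h : MemLp w 2 (vol X)) :
    LocallyIntegrableOn w (Omega X) :=
  IntegrableOn.locallyIntegrableOn (h.integrable (by norm_num))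

lemma IsL2Deriv.isWeakDeriv (h : IsL2Deriv X e w g) : IsWeakDeriv X e w g :=
  ⟨h.memLp.locallyIntegrableOn_Omega, h.memLp_deriv.locallyIntegrableOn_Omega, h.integral_eq⟩

lemma integral_vol_eq_integral (hφ : tsupport φ ⊆ Omega X) :
    ∫ p, g p * φ p ∂(vol X) = ∫ p, g p * φ p := by
  refine setIntegral_eq_integral_of_forall_compl_eq_zero fun p hp => ?_
  rw [image_eq_zero_of_notMem_tsupport fun h => hp (hφ h), mul_zero]

lemma integrable_mul_of_hasCompactSupport (hg : LocallyIntegrableOn g (Omega X))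
    (hφ : Continuous φ) (hc : HasCompactSupport φ) (hs : tsupport φ ⊆ Omega X) :
    Integrable (fun p => g p * φ p) (vol X) := by
  have h1 : IntegrableOn g (tsupport φ) := hg.integrableOn_compact_subset hs hc
  have h2 : IntegrableOn (fun p => g p * φ p) (tsupport φ) :=
    h1.mul_continuousOn hφ.continuousOn hc
  have h3 : Integrable (fun p => g p * φ p) := by
    refine (integrableOn_iff_integrable_of_support_subset ?_).1 h2
    exact (Function.support_mul_subset_right _ _).trans (subset_tsupport _)
  exact h3.restrict

/-- The fundamental lemma of the calculus of variations. Since `weakDeriv` is an arbitrary choice,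
every computation with it goes through this uniqueness. -/
lemma IsWeakDeriv.ae_eq (h : IsWeakDeriv X e w g) (h' : IsWeakDeriv X e w g') :
    g =ᵐ[vol X] g' := by
  have key := (isOpen_Omega X).ae_eq_zero_of_integral_contDiff_smul_eq_zero
    (μ := volume) (f := fun p => g p - g' p) (h.2.1.sub h'.2.1) (by
      intro φ hφ hc hs
      have e1 := h.2.2 φ hφ hc hs
      have e2 := h'.2.2 φ hφ hc hs
      have i1 := integrable_mul_of_hasCompactSupport h.2.1 hφ.continuous hc hs
      have i2 := integrable_mul_of_hasCompactSupport h'.2.1 hφ.continuous hc hs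
      have : ∫ p, φ p • (g p - g' p) = ∫ p, (g p - g' p) * φ p := by
        simp only [smul_eq_mul, mul_comm]
      rw [this, ← integral_vol_eq_integral (g := fun p => g p - g' p) hs]
      simp only [sub_mul]
      rw [integral_sub i1 i2]
      linarith)
  rw [Filter.EventuallyEq, vol, ae_restrict_iff' (measurableSet_Omega X)]
  filter_upwards [key] with p hp hpO
  exact sub_eq_zero.1 (hp hpO)

lemma isWeakDeriv_weakDeriv (h : IsWeakDeriv X e w g) :
    IsWeakDeriv X e w (weakDeriv X e w) := by
  have h' : ∃ g, IsWeakDeriv X e w g := ⟨g, h⟩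
  rw [weakDeriv, dif_pos h']
  exact h'.choose_spec

lemma IsL2Deriv.weakDeriv_ae_eq (h : IsL2Deriv X e w g) : weakDeriv X e w =ᵐ[vol X] g :=
  (isWeakDeriv_weakDeriv h.isWeakDeriv).ae_eq h.isWeakDeriv

lemma isL2Deriv_weakDeriv (hw : MemLp w 2 (vol X))
    (h : ∃ g, IsWeakDeriv X e w g ∧ MemLp g 2 (vol X)) : IsL2Deriv X e w (weakDeriv X e w) := by
  obtain ⟨g, hg, hg2⟩ := h
  have := isWeakDeriv_weakDeriv hg
  exact ⟨hw, hg2.ae_eq (hg.ae_eq this), this.2.2⟩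

lemma MemH1.dx (h : MemH1 X w) : IsL2Deriv X (1, 0) w (Dx X w) := isL2Deriv_weakDeriv h.1 h.2.1

lemma MemH1.dv (h : MemH1 X w) : IsL2Deriv X (0, 1) w (Dv X w) := isL2Deriv_weakDeriv h.1 h.2.2

lemma MemH1.of_isL2Deriv (hx : IsL2Deriv X (1, 0) w g) (hv : IsL2Deriv X (0, 1) w g') :
    MemH1 X w :=
  ⟨hx.memLp, ⟨g, hx.isWeakDeriv, hx.memLp_deriv⟩, ⟨g', hv.isWeakDeriv, hv.memLp_deriv⟩⟩

lemma continuous_fderiv_apply (hφ : ContDiff ℝ ∞ φ) (e : ℝ × ℝ) :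
    Continuous fun p => fderiv ℝ φ p e :=
  (hφ.continuous_fderiv (by simp)).clm_apply continuous_const

lemma contDiff_fderiv_apply (hφ : ContDiff ℝ ∞ φ) (e : ℝ × ℝ) :
    ContDiff ℝ ∞ fun p => fderiv ℝ φ p e :=
  (hφ.fderiv_right (m := ∞) (by simp)).clm_apply contDiff_const

lemma tsupport_fderiv_const_apply_subset (φ : ℝ × ℝ → ℝ) (e : ℝ × ℝ) :
    tsupport (fun p => fderiv ℝ φ p e) ⊆ tsupport φ :=
  tsupport_fderiv_apply_subset ℝ e

lemma hasCompactSupport_fderiv_apply (hc : HasCompactSupport φ) (e : ℝ × ℝ) :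
    HasCompactSupport fun p => fderiv ℝ φ p e := hc.fderiv_apply ℝ e

lemma memLp_linComb (hw : MemLp w 2 (vol X)) (hw' : MemLp w' 2 (vol X)) (a b : ℝ) :
    MemLp (fun p => a * w p + b * w' p) 2 (vol X) :=
  (hw.const_mul a).add (hw'.const_mul b)

lemma memLp_snd_mul (hw : MemLp w 2 (vol X)) : MemLp (fun p => p.2 * w p) 2 (vol X) := by
  refine hw.mono (measurable_snd.aestronglyMeasurable.mul hw.1) ?_
  filter_upwards [ae_abs_snd_le X] with p hp
  rw [norm_mul, Real.norm_eq_abs p.2]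
  exact mul_le_of_le_one_left (norm_nonneg _) hp

lemma IsL2Deriv.linComb (h : IsL2Deriv X e w g) (h' : IsL2Deriv X e w' g') (a b : ℝ) :
    IsL2Deriv X e (fun p => a * w p + b * w' p) (fun p => a * g p + b * g' p) := by
  refine ⟨memLp_linComb h.memLp h'.memLp a b, memLp_linComb h.memLp_deriv h'.memLp_deriv a b, ?_⟩
  intro φ hφ hc hs
  have i1 := integrable_mul_of_hasCompactSupport h.isWeakDeriv.2.1 hφ.continuous hc hs
  have i2 := integrable_mul_of_hasCompactSupport h'.isWeakDeriv.2.1 hφ.continuous hc hs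
  have hs' := (tsupport_fderiv_const_apply_subset φ e).trans hs
  have i3 := integrable_mul_of_hasCompactSupport h.isWeakDeriv.1
    (continuous_fderiv_apply hφ e) (hasCompactSupport_fderiv_apply hc e) hs'
  have i4 := integrable_mul_of_hasCompactSupport h'.isWeakDeriv.1
    (continuous_fderiv_apply hφ e) (hasCompactSupport_fderiv_apply hc e) hs'
  simp only [add_mul, mul_assoc]
  rw [integral_add (i3.const_mul a) (i4.const_mul b), integral_add (i1.const_mul a)
    (i2.const_mul b)]
  simp only [integral_const_mul]
  rw [h.integral_eq φ hφ hc hs, h'.integral_eq φ hφ hc hs]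
  ring

/-- The product rule for multiplication by the velocity. -/
lemma IsL2Deriv.snd_mul (h : IsL2Deriv X e w g) :
    IsL2Deriv X e (fun p => p.2 * w p) (fun p => e.2 * w p + p.2 * g p) := by
  refine ⟨memLp_snd_mul h.memLp, (h.memLp.const_mul e.2).add (memLp_snd_mul h.memLp_deriv), ?_⟩
  intro φ hφ hc hs
  have hψ : ContDiff ℝ ∞ fun p : ℝ × ℝ => p.2 * φ p := contDiff_snd.mul hφ
  have hψc : HasCompactSupport fun p : ℝ × ℝ => p.2 * φ p := hc.mul_left
  have hψs : tsupport (fun p : ℝ × ℝ => p.2 * φ p) ⊆ Omega X :=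
    (tsupport_mul_subset_right).trans hs
  have key := h.integral_eq _ hψ hψc hψs
  have hd : ∀ p, fderiv ℝ (fun p : ℝ × ℝ => p.2 * φ p) p e = p.2 * fderiv ℝ φ p e + φ p * e.2 := by
    intro p
    have h1 : HasFDerivAt (fun p : ℝ × ℝ => p.2 * φ p) _ p :=
      (hasFDerivAt_snd (𝕜 := ℝ) (p := p)).mul (hφ.differentiable (by simp) p).hasFDerivAt
    rw [h1.fderiv]
    simp
  have i1 := integrable_mul_of_hasCompactSupport h.isWeakDeriv.1 hφ.continuous hc hs
  have i2 := integrable_mul_of_hasCompactSupport h.isWeakDeriv.2.1 hψ.continuous hψc hψs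
  have hs' := (tsupport_fderiv_const_apply_subset φ e).trans hs
  have i3 := integrable_mul_of_hasCompactSupport (memLp_snd_mul h.memLp).locallyIntegrableOn_Omega
    (continuous_fderiv_apply hφ e) (hasCompactSupport_fderiv_apply hc e) hs'
  have e1 : ∫ p, w p * fderiv ℝ (fun p : ℝ × ℝ => p.2 * φ p) p e ∂(vol X) =
      ∫ p, p.2 * w p * fderiv ℝ φ p e ∂(vol X) + e.2 * ∫ p, w p * φ p ∂(vol X) := by
    rw [← integral_const_mul, ← integral_add i3 (i1.const_mul e.2)]
    congr 1 with p
    rw [hd]; ring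
  have e2 : ∫ p, (e.2 * w p + p.2 * g p) * φ p ∂(vol X) =
      e.2 * ∫ p, w p * φ p ∂(vol X) + ∫ p, g p * (p.2 * φ p) ∂(vol X) := by
    rw [← integral_const_mul, ← integral_add (i1.const_mul e.2) i2]
    congr 1 with p
    ring
  linarith

lemma fderiv_fderiv_apply_comm (hφ : ContDiff ℝ ∞ φ) (p e e' : ℝ × ℝ) :
    fderiv ℝ (fun q => fderiv ℝ φ q e) p e' = fderiv ℝ (fun q => fderiv ℝ φ q e') p e := by
  have hd : DifferentiableAt ℝ (fderiv ℝ φ) p :=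
    (hφ.fderiv_right (m := 1) (by norm_cast)).differentiable (by simp) p
  have hsymm : IsSymmSndFDerivAt ℝ φ p :=
    hφ.contDiffAt.isSymmSndFDerivAt (by
      simpa using (WithTop.coe_le_coe.2 le_top : ((2 : ℕ∞) : WithTop ℕ∞) ≤ ∞))
  have key : ∀ a b : ℝ × ℝ, fderiv ℝ (fun q => fderiv ℝ φ q a) p b
      = fderiv ℝ (fderiv ℝ φ) p b a := by
    intro a b
    rw [fderiv_clm_apply hd (differentiableAt_const a)]
    simp
  rw [key, key]
  exact hsymm e' e

/-- Mixed weak derivatives commute. -/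
lemma IsL2Deriv.swap {e' : ℝ × ℝ} {k : ℝ × ℝ → ℝ} (h : IsL2Deriv X e w g)
    (h' : IsL2Deriv X e' w g') (hk : IsL2Deriv X e g' k) : IsL2Deriv X e' g k := by
  refine ⟨h.memLp_deriv, hk.memLp_deriv, fun φ hφ hc hs => ?_⟩
  have hs1 := fun e => (tsupport_fderiv_const_apply_subset φ e).trans hs
  have hc1 := hasCompactSupport_fderiv_apply hc
  have e1 := h.integral_eq _ (contDiff_fderiv_apply hφ e') (hc1 e') (hs1 e')
  have e2 := h'.integral_eq _ (contDiff_fderiv_apply hφ e) (hc1 e) (hs1 e)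
  have e3 := hk.integral_eq _ hφ hc hs
  -- Both derivatives are moved onto the test function, where Schwarz's theorem applies.
  simp only [fderiv_fderiv_apply_comm hφ _ e' e] at e1
  linarith

end Kolmogorov

namespace Kolmogorov

/-! ### Boundary terms of smooth functions -/

variable {X : ℝ} {Γ : Set (ℝ × ℝ)} {h φ g w : ℝ × ℝ → ℝ}

lemma integrable_vol_of_continuous (hh : Continuous h) : Integrable h (vol X) := by
  have : IntegrableOn h (Set.Icc (-X) X ×ˢ Set.Icc (-1 : ℝ) 1) :=
    hh.continuousOn.integrableOn_compact (isCompact_Icc.prod isCompact_Icc)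
  exact this.mono_set (Set.prod_mono Set.Ioo_subset_Icc_self Set.Ioo_subset_Icc_self)

lemma integrableOn_Ioo_of_continuous {k : ℝ → ℝ} (hk : Continuous k) (a b : ℝ) :
    IntegrableOn k (Set.Ioo a b) :=
  (hk.continuousOn.integrableOn_compact isCompact_Icc).mono_set Set.Ioo_subset_Icc_self

lemma integral_vol_eq_integral_fst (hh : Continuous h) :
    ∫ p, h p ∂(vol X) = ∫ x in Set.Ioo (-X) X, ∫ v in Set.Ioo (-1 : ℝ) 1, h (x, v) := by
  have := integrable_vol_of_continuous (X := X) hh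
  rw [vol_eq_prod] at this ⊢
  exact integral_prod _ this

lemma integral_vol_eq_integral_snd (hh : Continuous h) :
    ∫ p, h p ∂(vol X) = ∫ v in Set.Ioo (-1 : ℝ) 1, ∫ x in Set.Ioo (-X) X, h (x, v) := by
  have := integrable_vol_of_continuous (X := X) hh
  rw [vol_eq_prod] at this ⊢
  exact integral_prod_symm _ this

lemma hasDerivAt_fst (hφ : ContDiff ℝ ∞ φ) (x v : ℝ) :
    HasDerivAt (fun x => φ (x, v)) (fderiv ℝ φ (x, v) (1, 0)) x :=
  (hφ.differentiable (by simp) (x, v)).hasFDerivAt.comp_hasDerivAt x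
    ((hasDerivAt_id x).prodMk (hasDerivAt_const x v))

lemma hasDerivAt_snd (hφ : ContDiff ℝ ∞ φ) (x v : ℝ) :
    HasDerivAt (fun v => φ (x, v)) (fderiv ℝ φ (x, v) (0, 1)) v :=
  (hφ.differentiable (by simp) (x, v)).hasFDerivAt.comp_hasDerivAt v
    ((hasDerivAt_const v x).prodMk (hasDerivAt_id v))

lemma setIntegral_Ioo_eq_sub {a b : ℝ} (hab : a ≤ b) {F F' : ℝ → ℝ}
    (hF : ∀ x, HasDerivAt F (F' x) x) (hF' : Continuous F') :
    ∫ x in Set.Ioo a b, F' x = F b - F a := by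
  rw [← integral_Ioc_eq_integral_Ioo, ← intervalIntegral.integral_of_le hab]
  exact intervalIntegral.integral_eq_sub_of_hasDerivAt (fun x _ => hF x)
    (hF'.intervalIntegrable _ _)

/-- For fixed `v` the integrand is the exact derivative `∂ₓ(v φ²/2)`. -/
lemma integral_transport (hX : 0 < X) (hφ : ContDiff ℝ ∞ φ) :
    ∫ p, p.2 * fderiv ℝ φ p (1, 0) * φ p ∂(vol X) =
      1 / 2 * ((∫ v in Set.Ioo (-1 : ℝ) 1, v * φ (X, v) ^ 2) -
        ∫ v in Set.Ioo (-1 : ℝ) 1, v * φ (-X, v) ^ 2) := by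
  have hc := hφ.continuous
  have hd := continuous_fderiv_apply hφ (1, 0)
  rw [integral_vol_eq_integral_snd (by fun_prop), ← integral_sub
    (integrableOn_Ioo_of_continuous (by fun_prop) _ _)
    (integrableOn_Ioo_of_continuous (by fun_prop) _ _), ← integral_const_mul]
  congr 1 with v
  have hF : ∀ x, HasDerivAt (fun x => v / 2 * φ (x, v) ^ 2)
      (v * fderiv ℝ φ (x, v) (1, 0) * φ (x, v)) x := by
    intro x
    refine (((hasDerivAt_fst hφ x v).pow 2).const_mul (v / 2)).congr_deriv ?_
    ring
  rw [setIntegral_Ioo_eq_sub (by linarith) hF (by fun_prop)]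
  ring

/-- Only `v < 0` contributes negatively, and there `|v| ≤ 1`. This and the next lemma bound the part
of the flux with the wrong sign by an unweighted boundary integral. -/
lemma neg_setIntegral_le_setIntegral_mul {k : ℝ → ℝ} (hk : Continuous k) (h0 : ∀ v, 0 ≤ k v) :
    -∫ v in Set.Ioo (-1 : ℝ) 0, k v ≤ ∫ v in Set.Ioo (-1 : ℝ) 1, v * k v := by
  have hsub : Set.Ioo (-1 : ℝ) 1 ∩ Set.Ioo (-1 : ℝ) 0 = Set.Ioo (-1 : ℝ) 0 :=
    Set.inter_eq_right.2 (Set.Ioo_subset_Ioo_right zero_le_one)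
  have e : ∫ v in Set.Ioo (-1 : ℝ) 0, k v =
      ∫ v in Set.Ioo (-1 : ℝ) 1, (Set.Ioo (-1 : ℝ) 0).indicator k v := by
    rw [setIntegral_indicator measurableSet_Ioo, hsub]
  rw [e, ← integral_neg]
  refine setIntegral_mono_on
    ((integrableOn_Ioo_of_continuous hk _ _).indicator measurableSet_Ioo).neg
    (integrableOn_Ioo_of_continuous (by fun_prop) _ _) measurableSet_Ioo fun v hv => ?_
  have := h0 v
  by_cases h : v < 0
  · rw [Set.indicator_of_mem (Set.mem_Ioo.2 ⟨hv.1, h⟩)]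
    nlinarith [hv.1]
  · rw [Set.indicator_of_notMem (fun h' => h h'.2), neg_zero]
    exact mul_nonneg (not_lt.1 h) this

lemma setIntegral_mul_le_setIntegral {k : ℝ → ℝ} (hk : Continuous k) (h0 : ∀ v, 0 ≤ k v) :
    ∫ v in Set.Ioo (-1 : ℝ) 1, v * k v ≤ ∫ v in Set.Ioo (0 : ℝ) 1, k v := by
  have hsub : Set.Ioo (-1 : ℝ) 1 ∩ Set.Ioo (0 : ℝ) 1 = Set.Ioo (0 : ℝ) 1 :=
    Set.inter_eq_right.2 (Set.Ioo_subset_Ioo_left (by norm_num))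
  have e : ∫ v in Set.Ioo (0 : ℝ) 1, k v =
      ∫ v in Set.Ioo (-1 : ℝ) 1, (Set.Ioo (0 : ℝ) 1).indicator k v := by
    rw [setIntegral_indicator measurableSet_Ioo, hsub]
  rw [e]
  refine setIntegral_mono_on (integrableOn_Ioo_of_continuous (by fun_prop) _ _)
    ((integrableOn_Ioo_of_continuous hk _ _).indicator measurableSet_Ioo)
    measurableSet_Ioo fun v hv => ?_
  have := h0 v
  by_cases h : 0 < v
  · rw [Set.indicator_of_mem (Set.mem_Ioo.2 ⟨h, hv.2⟩)]
    nlinarith [hv.2]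
  · rw [Set.indicator_of_notMem (fun h' => h h'.1)]
    exact mul_nonpos_of_nonpos_of_nonneg (not_lt.1 h) this

lemma integrable_map_Ioo (hh : Continuous h) {j : ℝ → ℝ × ℝ} (hj : Continuous j) (a b : ℝ) :
    Integrable h (Measure.map j (volume.restrict (Set.Ioo a b))) := by
  rw [integrable_map_measure hh.aestronglyMeasurable hj.measurable.aemeasurable]
  exact integrableOn_Ioo_of_continuous (hh.comp hj) a b

lemma setIntegral_comp_le_integral_map (hh : Continuous h) (h0 : ∀ p, 0 ≤ h p) {j : ℝ → ℝ × ℝ}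
    (hj : Continuous j) {a b : ℝ} (hΓ : MeasurableSet Γ) {A : Set ℝ}
    (hA : A ⊆ Set.Ioo a b ∩ j ⁻¹' Γ) :
    ∫ t in A, h (j t) ≤ ∫ p, h p ∂((Measure.map j (volume.restrict (Set.Ioo a b))).restrict Γ) := by
  rw [Measure.restrict_map hj.measurable hΓ, integral_map hj.measurable.aemeasurable
    hh.aestronglyMeasurable, Measure.restrict_restrict (hj.measurable hΓ)]
  refine setIntegral_mono_set ?_ (Eventually.of_forall fun t => h0 (j t))
    (LE.le.eventuallyLE (by rwa [Set.inter_comm]))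
  exact (integrableOn_Ioo_of_continuous (hh.comp hj) a b).mono_set Set.inter_subset_right

/-- The sets `Aᵢ` are the portions of the four sides that are kept; they may be smaller than `Γ`, so
corners, endpoints and irrelevant sides can be dropped. -/
lemma add_le_integral_arcLength (hh : Continuous h) (h0 : ∀ p, 0 ≤ h p) (hΓ : MeasurableSet Γ)
    {A₁ A₂ A₃ A₄ : Set ℝ}
    (h₁ : A₁ ⊆ Set.Ioo (-1) 1 ∩ (fun v => (-X, v)) ⁻¹' Γ)
    (h₂ : A₂ ⊆ Set.Ioo (-1) 1 ∩ (fun v => (X, v)) ⁻¹' Γ)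
    (h₃ : A₃ ⊆ Set.Ioo (-X) X ∩ (fun x => (x, -1)) ⁻¹' Γ)
    (h₄ : A₄ ⊆ Set.Ioo (-X) X ∩ (fun x => (x, 1)) ⁻¹' Γ) :
    (∫ v in A₁, h (-X, v)) + (∫ v in A₂, h (X, v)) + (∫ x in A₃, h (x, -1)) +
      (∫ x in A₄, h (x, 1)) ≤ ∫ p, h p ∂((arcLength X).restrict Γ) := by
  have c₁ : Continuous fun v : ℝ => (-X, v) := by fun_prop
  have c₂ : Continuous fun v : ℝ => (X, v) := by fun_prop
  have c₃ : Continuous fun x : ℝ => (x, (-1 : ℝ)) := by fun_prop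
  have c₄ : Continuous fun x : ℝ => (x, (1 : ℝ)) := by fun_prop
  have i₁ := (integrable_map_Ioo hh c₁ (-1) 1).restrict (s := Γ)
  have i₂ := (integrable_map_Ioo hh c₂ (-1) 1).restrict (s := Γ)
  have i₃ := (integrable_map_Ioo hh c₃ (-X) X).restrict (s := Γ)
  have i₄ := (integrable_map_Ioo hh c₄ (-X) X).restrict (s := Γ)
  rw [arcLength, Measure.restrict_add, Measure.restrict_add, Measure.restrict_add,
    integral_add_measure ((i₁.add_measure i₂).add_measure i₃) i₄,
    integral_add_measure (i₁.add_measure i₂) i₃, integral_add_measure i₁ i₂]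
  have := setIntegral_comp_le_integral_map hh h0 c₁ hΓ h₁
  have := setIntegral_comp_le_integral_map hh h0 c₂ hΓ h₂
  have := setIntegral_comp_le_integral_map hh h0 c₃ hΓ h₃
  have := setIntegral_comp_le_integral_map hh h0 c₄ hΓ h₄
  linarith

lemma measurableSet_parabolic (X : ℝ) : MeasurableSet (parabolic X) :=
  measurableSet_Ioo.prod ((measurableSet_singleton _).insert _)

lemma measurableSet_gammaMinus (X : ℝ) : MeasurableSet (gammaMinus X) :=
  (((measurableSet_singleton _).prod measurableSet_Ico).union
    ((measurableSet_singleton _).prod measurableSet_Ioc)).union (measurableSet_parabolic X)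

lemma measurableSet_gammaPlus (X : ℝ) : MeasurableSet (gammaPlus X) :=
  (((measurableSet_singleton _).prod measurableSet_Ioo).union
    ((measurableSet_singleton _).prod measurableSet_Ioo)).union (measurableSet_parabolic X)

/-- The flux is negative only where `v > 0` at `x = -X` or `v < 0` at `x = X`, which lies in `Γ⁻`.
The factor `1` is the sign `σ` of `transport_of_zeroTrace`. -/
lemma transport_gammaMinus_of_contDiff (hX : 0 < X) (hφ : ContDiff ℝ ∞ φ) :
    0 ≤ 1 * (∫ p, p.2 * fderiv ℝ φ p (1, 0) * φ p ∂(vol X)) +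
      1 / 2 * ∫ p, φ p ^ 2 ∂((arcLength X).restrict (gammaMinus X)) := by
  have hc := hφ.continuous
  rw [integral_transport hX hφ]
  have h1 := add_le_integral_arcLength (X := X) (h := fun p => φ p ^ 2) (by fun_prop)
    (fun p => sq_nonneg _) (measurableSet_gammaMinus X) (A₁ := Set.Ioo 0 1) (A₂ := Set.Ioo (-1) 0)
    (A₃ := ∅) (A₄ := ∅)
    (fun v hv => ⟨⟨by linarith [hv.1], hv.2⟩, Or.inl (Or.inl ⟨rfl, hv.1.le, hv.2⟩)⟩)
    (fun v hv => ⟨⟨hv.1, by linarith [hv.2]⟩, Or.inl (Or.inr ⟨rfl, hv.1, hv.2.le⟩)⟩)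
    (Set.empty_subset _) (Set.empty_subset _)
  have h2 := neg_setIntegral_le_setIntegral_mul (k := fun v => φ (X, v) ^ 2) (by fun_prop)
    (fun v => sq_nonneg _)
  have h3 := setIntegral_mul_le_setIntegral (k := fun v => φ (-X, v) ^ 2) (by fun_prop)
    (fun v => sq_nonneg _)
  simp only [Measure.restrict_empty, integral_zero_measure] at h1
  linarith

lemma transport_gammaPlus_of_contDiff (hX : 0 < X) (hφ : ContDiff ℝ ∞ φ) :
    0 ≤ (-1) * (∫ p, p.2 * fderiv ℝ φ p (1, 0) * φ p ∂(vol X)) +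
      1 / 2 * ∫ p, φ p ^ 2 ∂((arcLength X).restrict (gammaPlus X)) := by
  have hc := hφ.continuous
  rw [integral_transport hX hφ]
  have h1 := add_le_integral_arcLength (X := X) (h := fun p => φ p ^ 2) (by fun_prop)
    (fun p => sq_nonneg _) (measurableSet_gammaPlus X) (A₁ := Set.Ioo (-1) 0) (A₂ := Set.Ioo 0 1)
    (A₃ := ∅) (A₄ := ∅)
    (fun v hv => ⟨⟨hv.1, by linarith [hv.2]⟩, Or.inl (Or.inl ⟨rfl, hv.1, hv.2⟩)⟩)
    (fun v hv => ⟨⟨by linarith [hv.1], hv.2⟩, Or.inl (Or.inr ⟨rfl, hv.1, hv.2⟩)⟩)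
    (Set.empty_subset _) (Set.empty_subset _)
  have h2 := neg_setIntegral_le_setIntegral_mul (k := fun v => φ (-X, v) ^ 2) (by fun_prop)
    (fun v => sq_nonneg _)
  have h3 := setIntegral_mul_le_setIntegral (k := fun v => φ (X, v) ^ 2) (by fun_prop)
    (fun v => sq_nonneg _)
  simp only [Measure.restrict_empty, integral_zero_measure] at h1
  linarith

/-- Integrate the derivative of `(1 - v) φ²`: the weight vanishes at `v = 1`, so only the trace at
`v = -1` enters. Young's inequality and `(1 - v)² ≤ 4` give the constants. -/
lemma poincare_slice (hφ : ContDiff ℝ ∞ φ) (x : ℝ) :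
    ∫ v in Set.Ioo (-1 : ℝ) 1, φ (x, v) ^ 2 ≤
      4 * φ (x, -1) ^ 2 + 16 * ∫ v in Set.Ioo (-1 : ℝ) 1, fderiv ℝ φ (x, v) (0, 1) ^ 2 := by
  have hc := hφ.continuous
  have hd := continuous_fderiv_apply hφ (0, 1)
  have hF : ∀ v, HasDerivAt (fun v => (1 - v) * φ (x, v) ^ 2)
      (2 * (1 - v) * fderiv ℝ φ (x, v) (0, 1) * φ (x, v) - φ (x, v) ^ 2) v := by
    intro v
    refine (((hasDerivAt_id v).const_sub 1).mul ((hasDerivAt_snd hφ x v).pow 2)).congr_deriv ?_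
    simp only [id, Pi.pow_apply]
    ring
  have key := setIntegral_Ioo_eq_sub (a := -1) (b := 1) (by norm_num) hF (by fun_prop)
  have i1 := integrableOn_Ioo_of_continuous (k := fun v => φ (x, v) ^ 2) (by fun_prop) (-1) 1
  have i2 := integrableOn_Ioo_of_continuous (k := fun v => fderiv ℝ φ (x, v) (0, 1) ^ 2)
    (by fun_prop) (-1) 1
  have hle : ∫ v in Set.Ioo (-1 : ℝ) 1,
      (2 * (1 - v) * fderiv ℝ φ (x, v) (0, 1) * φ (x, v) - φ (x, v) ^ 2) ≤
      ∫ v in Set.Ioo (-1 : ℝ) 1,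
        (8 * fderiv ℝ φ (x, v) (0, 1) ^ 2 - 1 / 2 * φ (x, v) ^ 2) := by
    refine setIntegral_mono_on (integrableOn_Ioo_of_continuous (by fun_prop) _ _)
      (integrableOn_Ioo_of_continuous (by fun_prop) _ _) measurableSet_Ioo fun v hv => ?_
    have h1 : 0 ≤ (2 - (1 - v)) * (2 + (1 - v)) := by nlinarith [hv.1, hv.2]
    nlinarith [sq_nonneg (2 * (1 - v) * fderiv ℝ φ (x, v) (0, 1) - φ (x, v)),
      mul_nonneg h1 (sq_nonneg (fderiv ℝ φ (x, v) (0, 1)))]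
  rw [integral_sub (i2.const_mul 8) (i1.const_mul (1 / 2)), integral_const_mul,
    integral_const_mul, key] at hle
  norm_num at hle
  linarith

lemma poincare_of_contDiff (hφ : ContDiff ℝ ∞ φ) (hΓ : MeasurableSet Γ) (hp : parabolic X ⊆ Γ) :
    ∫ p, φ p ^ 2 ∂(vol X) ≤ 4 * (∫ p, φ p ^ 2 ∂((arcLength X).restrict Γ)) +
      16 * ∫ p, fderiv ℝ φ p (0, 1) ^ 2 ∂(vol X) := by
  have hc := hφ.continuous
  have hd := continuous_fderiv_apply hφ (0, 1)
  have h1 := add_le_integral_arcLength (X := X) (h := fun p => φ p ^ 2) (by fun_prop)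
    (fun p => sq_nonneg _) hΓ (A₁ := ∅) (A₂ := ∅) (A₃ := Set.Ioo (-X) X) (A₄ := ∅)
    (Set.empty_subset _) (Set.empty_subset _)
    (fun x hx => ⟨hx, hp ⟨hx, by simp⟩⟩) (Set.empty_subset _)
  simp only [Measure.restrict_empty, integral_zero_measure] at h1
  have i1 : Integrable (fun p => φ p ^ 2) (vol X) := integrable_vol_of_continuous (by fun_prop)
  have i2 : Integrable (fun p => fderiv ℝ φ p (0, 1) ^ 2) (vol X) :=
    integrable_vol_of_continuous (by fun_prop)
  rw [vol_eq_prod] at i1 i2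
  have i3 := integrableOn_Ioo_of_continuous (k := fun x => φ (x, -1) ^ 2) (by fun_prop) (-X) X
  have h2 : ∫ x in Set.Ioo (-X) X, ∫ v in Set.Ioo (-1 : ℝ) 1, φ (x, v) ^ 2 ≤
      ∫ x in Set.Ioo (-X) X, (4 * φ (x, -1) ^ 2 +
        16 * ∫ v in Set.Ioo (-1 : ℝ) 1, fderiv ℝ φ (x, v) (0, 1) ^ 2) :=
    integral_mono i1.integral_prod_left ((i3.const_mul 4).add (i2.integral_prod_left.const_mul 16))
      (poincare_slice hφ)
  rw [integral_add (i3.const_mul 4) (i2.integral_prod_left.const_mul 16), integral_const_mul,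
    integral_const_mul] at h2
  rw [integral_vol_eq_integral_fst (by fun_prop), integral_vol_eq_integral_fst (by fun_prop)]
  linarith

/-! ### Functions with vanishing trace -/

lemma memLp_of_contDiff (hφ : Continuous φ) : MemLp φ 2 (vol X) := by
  rw [memLp_two_iff_integrable_sq hφ.aestronglyMeasurable]
  exact integrable_vol_of_continuous (by fun_prop)

/-- The transport integral is continuous in `H¹`, so the smooth inequality survives the limit.
Young's inequality with a parameter `t` splits the error into `t/2 · K` plus a multiple of the
squared `H¹` distance; first `n → ∞`, then `t` is taken small. -/
lemma transport_of_zeroTrace {σ : ℝ} (hσ : |σ| = 1)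
    (hΓ : ∀ φ : ℝ × ℝ → ℝ, ContDiff ℝ ∞ φ →
      0 ≤ σ * (∫ p, p.2 * fderiv ℝ φ p (1, 0) * φ p ∂(vol X)) +
        1 / 2 * ∫ p, φ p ^ 2 ∂((arcLength X).restrict Γ))
    (hg : MemH1 X g) (hz : ZeroTrace X Γ g) :
    0 ≤ σ * ∫ p, p.2 * Dx X g p * g p ∂(vol X) := by
  obtain ⟨φ, hφ, h1, h2⟩ := hz
  have m0 := hg.1
  have mx := hg.dx.memLp_deriv
  have mv := hg.dv.memLp_deriv
  set K := ∫ p, (g p ^ 2 + Dx X g p ^ 2) ∂(vol X) with hK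
  have hK0 : 0 ≤ K := integral_nonneg fun p => by positivity
  have iK : Integrable (fun p => g p ^ 2 + Dx X g p ^ 2) (vol X) :=
    m0.integrable_sq.add mx.integrable_sq
  have iI : Integrable (fun p => p.2 * Dx X g p * g p) (vol X) :=
    (memLp_snd_mul mx).integrable_mul m0
  have step : ∀ t : ℝ, 0 < t → 0 ≤ σ * (∫ p, p.2 * Dx X g p * g p ∂(vol X)) + t / 2 * K := by
    intro t ht
    -- Here `1/(2t)` comes from the two mixed products and `1/2` from the product of the two errors.
    have lim := (h1.const_mul (1 / (2 * t) + 1 / 2)).add (h2.const_mul (1 / 2))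
    have lim' := lim.const_add (σ * (∫ p, p.2 * Dx X g p * g p ∂(vol X)) + t / 2 * K)
    simp only [mul_zero, add_zero] at lim'
    refine ge_of_tendsto' lim' fun n => ?_
    have hc := (hφ n).continuous
    have hd := continuous_fderiv_apply (hφ n) (1, 0)
    have hd' := continuous_fderiv_apply (hφ n) (0, 1)
    have iE : Integrable (fun p => (φ n p - g p) ^ 2 + (fderiv ℝ (φ n) p (1, 0) - Dx X g p) ^ 2 +
        (fderiv ℝ (φ n) p (0, 1) - Dv X g p) ^ 2) (vol X) :=
      (((memLp_of_contDiff hc).sub m0).integrable_sq.add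
        ((memLp_of_contDiff hd).sub mx).integrable_sq).add
        ((memLp_of_contDiff hd').sub mv).integrable_sq
    have iφ : Integrable (fun p => p.2 * fderiv ℝ (φ n) p (1, 0) * φ n p) (vol X) :=
      integrable_vol_of_continuous (by fun_prop)
    have iIK : Integrable (fun p => σ * (p.2 * Dx X g p * g p) +
        t / 2 * (g p ^ 2 + Dx X g p ^ 2)) (vol X) := (iI.const_mul _).add (iK.const_mul _)
    have hle : σ * ∫ p, p.2 * fderiv ℝ (φ n) p (1, 0) * φ n p ∂(vol X) ≤
        σ * (∫ p, p.2 * Dx X g p * g p ∂(vol X)) + t / 2 * K + (1 / (2 * t) + 1 / 2) *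
        ∫ p, ((φ n p - g p) ^ 2 + (fderiv ℝ (φ n) p (1, 0) - Dx X g p) ^ 2 +
          (fderiv ℝ (φ n) p (0, 1) - Dv X g p) ^ 2) ∂(vol X) := by
      rw [hK, ← integral_const_mul, ← integral_const_mul, ← integral_const_mul,
        ← integral_const_mul, ← integral_add (iI.const_mul _) (iK.const_mul _),
        ← integral_add iIK (iE.const_mul _)]
      refine integral_mono_ae (iφ.const_mul _) (iIK.add (iE.const_mul _)) ?_
      filter_upwards [ae_abs_snd_le X] with p hp
      set b := φ n p - g p with hb
      set a := fderiv ℝ (φ n) p (1, 0) - Dx X g p with ha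
      set c := fderiv ℝ (φ n) p (0, 1) - Dv X g p
      have e1 : φ n p = g p + b := by rw [hb]; ring
      have e2 : fderiv ℝ (φ n) p (1, 0) = Dx X g p + a := by rw [ha]; ring
      rw [e1, e2]
      have hsv : |σ * p.2| ≤ 1 := by rw [abs_mul, hσ, one_mul]; exact hp
      have young : ∀ y z : ℝ, σ * p.2 * (y * z) ≤ t / 2 * y ^ 2 + 1 / (2 * t) * z ^ 2 := by
        intro y z
        have h3 : σ * p.2 * (y * z) ≤ |y| * |z| := by
          calc σ * p.2 * (y * z) ≤ |σ * p.2 * (y * z)| := le_abs_self _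
            _ = |σ * p.2| * (|y| * |z|) := by rw [abs_mul, abs_mul y]
            _ ≤ _ := mul_le_of_le_one_left (by positivity) hsv
        have h4 : t / 2 * y ^ 2 + 1 / (2 * t) * z ^ 2 - |y| * |z| =
            (t * |y| - |z|) ^ 2 / (2 * t) := by
          rw [← sq_abs y, ← sq_abs z]; field_simp; ring
        have : 0 ≤ (t * |y| - |z|) ^ 2 / (2 * t) := by positivity
        linarith
      have y1 := young (g p) a
      have y2 := young (Dx X g p) b
      have y3 : σ * p.2 * (a * b) ≤ 1 / 2 * (a ^ 2 + b ^ 2) := by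
        have h3 : σ * p.2 * (a * b) ≤ |a| * |b| := by
          calc σ * p.2 * (a * b) ≤ |σ * p.2 * (a * b)| := le_abs_self _
            _ = |σ * p.2| * (|a| * |b|) := by rw [abs_mul, abs_mul a]
            _ ≤ _ := mul_le_of_le_one_left (by positivity) hsv
        nlinarith [sq_nonneg (|a| - |b|), sq_abs a, sq_abs b]
      have hc0 : 0 ≤ (1 / (2 * t) + 1 / 2) * c ^ 2 := by positivity
      linarith
    have := hΓ (φ n) (hφ n)
    linarith
  by_contra hneg
  push Not at hneg
  -- For a negative integral `I = σ∫…`, the choice `t = -I/(K + 1)` gives `tK ≤ -I`, hence `0 ≤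
  -- I/2`, a contradiction.
  have := step (-(σ * ∫ p, p.2 * Dx X g p * g p ∂(vol X)) / (K + 1)) (by
    apply div_pos <;> linarith)
  have hlt : -(σ * ∫ p, p.2 * Dx X g p * g p ∂(vol X)) / (K + 1) * K ≤
      -(σ * ∫ p, p.2 * Dx X g p * g p ∂(vol X)) := by
    rw [div_mul_eq_mul_div, div_le_iff₀ (by linarith)]
    nlinarith
  linarith

lemma poincare_of_zeroTrace (hΓ : MeasurableSet Γ) (hp : parabolic X ⊆ Γ) (hw : MemH1 X w)
    (hz : ZeroTrace X Γ w) : innerL2 X w w ≤ 64 * innerL2 X (Dv X w) (Dv X w) := by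
  obtain ⟨φ, hφ, h1, h2⟩ := hz
  have m0 := hw.1
  have mx := hw.dx.memLp_deriv
  have mv := hw.dv.memLp_deriv
  -- From `w² ≤ 2φ² + 2(φ - w)²` and `φ_v² ≤ 2w_v² + 2(φ_v - w_v)²`: the boundary factor is `2·4`,
  -- the gradient factor `2·16·2 = 64`, and the error factor `64 + 2`.
  have lim := (h2.const_mul 8).add (h1.const_mul 66)
  have lim' := lim.const_add (64 * innerL2 X (Dv X w) (Dv X w))
  simp only [mul_zero, add_zero] at lim'
  refine ge_of_tendsto' lim' fun n => ?_
  have hc := (hφ n).continuous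
  have hd := continuous_fderiv_apply (hφ n) (1, 0)
  have hd' := continuous_fderiv_apply (hφ n) (0, 1)
  have i0 : Integrable (fun p => w p * w p) (vol X) := m0.integrable_mul m0
  have iv : Integrable (fun p => Dv X w p * Dv X w p) (vol X) := mv.integrable_mul mv
  have iE : Integrable (fun p => (φ n p - w p) ^ 2 + (fderiv ℝ (φ n) p (1, 0) - Dx X w p) ^ 2 +
      (fderiv ℝ (φ n) p (0, 1) - Dv X w p) ^ 2) (vol X) :=
    (((memLp_of_contDiff hc).sub m0).integrable_sq.add
      ((memLp_of_contDiff hd).sub mx).integrable_sq).add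
      ((memLp_of_contDiff hd').sub mv).integrable_sq
  have iφ : Integrable (fun p => φ n p ^ 2) (vol X) := integrable_vol_of_continuous (by fun_prop)
  have iφv : Integrable (fun p => fderiv ℝ (φ n) p (0, 1) ^ 2) (vol X) :=
    integrable_vol_of_continuous (by fun_prop)
  have iφw : Integrable (fun p => 2 * φ n p ^ 2 + 64 * (Dv X w p * Dv X w p)) (vol X) :=
    (iφ.const_mul _).add (iv.const_mul _)
  have key := poincare_of_contDiff (X := X) (hφ n) hΓ hp
  have hle : innerL2 X w w + 32 * (∫ p, fderiv ℝ (φ n) p (0, 1) ^ 2 ∂(vol X)) ≤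
      2 * (∫ p, φ n p ^ 2 ∂(vol X)) + 64 * innerL2 X (Dv X w) (Dv X w) +
      66 * ∫ p, ((φ n p - w p) ^ 2 + (fderiv ℝ (φ n) p (1, 0) - Dx X w p) ^ 2 +
          (fderiv ℝ (φ n) p (0, 1) - Dv X w p) ^ 2) ∂(vol X) := by
    unfold innerL2
    rw [← integral_const_mul, ← integral_const_mul, ← integral_const_mul, ← integral_const_mul,
      ← integral_add i0 (iφv.const_mul _), ← integral_add (iφ.const_mul _) (iv.const_mul _),
      ← integral_add iφw (iE.const_mul _)]
    refine integral_mono (i0.add (iφv.const_mul _)) (iφw.add (iE.const_mul _)) fun p => ?_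
    simp only
    nlinarith [sq_nonneg (2 * φ n p - w p), sq_nonneg (fderiv ℝ (φ n) p (1, 0) - Dx X w p),
      sq_nonneg (fderiv ℝ (φ n) p (0, 1) - 2 * Dv X w p), sq_nonneg (φ n p - w p)]
  linarith

end Kolmogorov

namespace Kolmogorov

/-! ### Spectral bounds for symmetric `2 × 2` matrices -/

variable {A M : Matrix (Fin 2) (Fin 2) ℝ}

/-- Subtracting `lambdaMin A` times the identity shifts the spectrum into `[0, ∞)`, so the
difference is positive semidefinite. -/
lemma lambdaMin_mul_le (hA : A.IsHermitian) (a b : ℝ) :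
    lambdaMin A * (a ^ 2 + b ^ 2) ≤ A 0 0 * a ^ 2 + (A 0 1 + A 1 0) * (a * b) + A 1 1 * b ^ 2 := by
  have hps : (A - algebraMap ℝ (Matrix (Fin 2) (Fin 2) ℝ) (lambdaMin A)).PosSemidef := by
    rw [Matrix.posSemidef_iff_isHermitian_and_spectrum_nonneg]
    refine ⟨hA.sub ?_, fun μ hμ => ?_⟩
    · rw [Algebra.algebraMap_eq_smul_one]
      exact Matrix.isHermitian_one.smul (by simp [IsSelfAdjoint])
    · have h1 : lambdaMin A + μ ∈ spectrum ℝ A := by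
        rw [add_comm, spectrum.add_mem_iff, neg_add_eq_sub]; exact hμ
      have h2 : lambdaMin A ≤ lambdaMin A + μ := csInf_le A.finite_real_spectrum.bddBelow h1
      simpa using h2
  have := hps.dotProduct_mulVec_nonneg ![a, b]
  simp [Matrix.mulVec, dotProduct, Fin.sum_univ_two, Matrix.algebraMap_matrix_apply] at this
  linarith

lemma le_lambdaMax_mul (hA : A.IsHermitian) (a b : ℝ) :
    A 0 0 * a ^ 2 + (A 0 1 + A 1 0) * (a * b) + A 1 1 * b ^ 2 ≤ lambdaMax A * (a ^ 2 + b ^ 2) := by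
  have hps : (algebraMap ℝ (Matrix (Fin 2) (Fin 2) ℝ) (lambdaMax A) - A).PosSemidef := by
    rw [Matrix.posSemidef_iff_isHermitian_and_spectrum_nonneg]
    refine ⟨Matrix.IsHermitian.sub ?_ hA, fun μ hμ => ?_⟩
    · rw [Algebra.algebraMap_eq_smul_one]
      exact Matrix.isHermitian_one.smul (by simp [IsSelfAdjoint])
    · have h0 : -μ ∈ spectrum ℝ (A - algebraMap ℝ (Matrix (Fin 2) (Fin 2) ℝ) (lambdaMax A)) := by
        rw [← neg_sub, ← spectrum.neg_eq]
        simpa using hμ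
      have h1 : lambdaMax A + -μ ∈ spectrum ℝ A := by
        rw [add_comm, spectrum.add_mem_iff, neg_add_eq_sub]; exact h0
      have h2 : lambdaMax A + -μ ≤ lambdaMax A := le_csSup A.finite_real_spectrum.bddAbove h1
      simpa using h2
  have := hps.dotProduct_mulVec_nonneg ![a, b]
  simp [Matrix.mulVec, dotProduct, Fin.sum_univ_two, Matrix.algebraMap_matrix_apply] at this
  linarith

lemma lambdaMin_pos (hA : A.PosDef) : 0 < lambdaMin A := by
  have hne : (spectrum ℝ A).Nonempty := by
    rw [hA.isHermitian.spectrum_real_eq_range_eigenvalues]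
    exact Set.range_nonempty _
  have := hne.csInf_mem A.finite_real_spectrum
  rw [hA.isHermitian.spectrum_real_eq_range_eigenvalues] at this
  obtain ⟨i, hi⟩ := this
  rw [lambdaMin, hA.isHermitian.spectrum_real_eq_range_eigenvalues, ← hi]
  exact hA.eigenvalues_pos i

lemma isHermitian_matN (ε : ℝ) (M : Matrix (Fin 2) (Fin 2) ℝ) : (matN ε M).IsHermitian := by
  ext i j
  fin_cases i <;> fin_cases j <;> simp [matN]

lemma posDef_matN {ε : ℝ} (hε : 0 < ε) (hMN : M 1 1 ^ 2 < 4 * ε * M 0 1) : (matN ε M).PosDef := by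
  refine Matrix.PosDef.of_dotProduct_mulVec_pos (isHermitian_matN ε M) fun x hx => ?_
  have h01 : 0 < M 0 1 := by
    by_contra h
    nlinarith [sq_nonneg (M 1 1), mul_nonneg hε.le (neg_nonneg.2 (not_lt.1 h))]
  have hx' : x 0 ≠ 0 ∨ x 1 ≠ 0 := by
    by_contra! h
    exact hx (by ext i; fin_cases i <;> simp [h.1, h.2])
  have key : 0 < M 0 1 * x 0 ^ 2 + M 1 1 * (x 0 * x 1) + ε * x 1 ^ 2 := by
    -- Completing the square turns the discriminant condition into positivity.
    have e : 4 * ε * (M 0 1 * x 0 ^ 2 + M 1 1 * (x 0 * x 1) + ε * x 1 ^ 2) =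
      (4 * ε * M 0 1 - M 1 1 ^ 2) * x 0 ^ 2 + (M 1 1 * x 0 + 2 * ε * x 1) ^ 2 := by ring
    have hpos : 0 < 4 * ε * (M 0 1 * x 0 ^ 2 + M 1 1 * (x 0 * x 1) + ε * x 1 ^ 2) := by
      rw [e]
      by_cases h0 : x 0 = 0
      · have h1 : x 1 ≠ 0 := hx'.resolve_left (not_not.2 h0)
        rw [h0]
        have : 0 < (2 * ε * x 1) ^ 2 := by positivity
        simpa using this
      · have : 0 < x 0 ^ 2 := by positivity
        have := mul_pos (sub_pos.2 hMN) this
        have := sq_nonneg (M 1 1 * x 0 + 2 * ε * x 1)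
        linarith
    exact pos_of_mul_pos_right hpos (by positivity)
  simp [Matrix.mulVec, dotProduct, Fin.sum_univ_two, matN]
  linarith

lemma lambdaMin_matN_mul_le (ε : ℝ) (M : Matrix (Fin 2) (Fin 2) ℝ) (a b : ℝ) :
    lambdaMin (matN ε M) * (a ^ 2 + b ^ 2) ≤ M 0 1 * a ^ 2 + M 1 1 * (a * b) + ε * b ^ 2 := by
  have := lambdaMin_mul_le (isHermitian_matN ε M) a b
  simpa [matN] using this

open scoped MatrixOrder in
lemma sqrtMat_symm (M : Matrix (Fin 2) (Fin 2) ℝ) : sqrtMat M 1 0 = sqrtMat M 0 1 := by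
  have h : (sqrtMat M).IsHermitian := (Matrix.nonneg_iff_posSemidef.1 (CFC.sqrt_nonneg M)).1
  simpa using h.apply 0 1

open scoped MatrixOrder in
lemma sqrtMat_mul_self (hM : M.PosSemidef) : sqrtMat M * sqrtMat M = M :=
  CFC.sqrt_mul_sqrt_self M hM.nonneg

/-- These identities are all that is needed of `√M`; its entries are never computed. -/
lemma sqrtMat_entries (hM : M.PosSemidef) :
    sqrtMat M 0 0 * sqrtMat M 0 0 + sqrtMat M 0 1 * sqrtMat M 0 1 = M 0 0 ∧
    sqrtMat M 0 0 * sqrtMat M 0 1 + sqrtMat M 0 1 * sqrtMat M 1 1 = M 0 1 ∧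
    sqrtMat M 0 1 * sqrtMat M 0 1 + sqrtMat M 1 1 * sqrtMat M 1 1 = M 1 1 := by
  have h := sqrtMat_mul_self hM
  have hs := sqrtMat_symm M
  have h00 := congrFun (congrFun h 0) 0
  have h01 := congrFun (congrFun h 0) 1
  have h11 := congrFun (congrFun h 1) 1
  simp only [Matrix.mul_apply, Fin.sum_univ_two, hs] at h00 h01 h11
  exact ⟨h00, h01, h11⟩

/-! ### The inner product `(·,·)_𝓗` -/

variable {X : ℝ} {w φ w' : ℝ × ℝ → ℝ}

lemma memLp_opH (hw : MemH1 X w) (i : Fin 3) : MemLp (opH X M w i) 2 (vol X) := by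
  have hx := hw.dx.memLp_deriv
  have hv := hw.dv.memLp_deriv
  fin_cases i
  · exact hw.1
  · exact memLp_linComb hx hv _ _
  · exact memLp_linComb hx hv _ _

lemma innerL2_comm (w φ : ℝ × ℝ → ℝ) : innerL2 X w φ = innerL2 X φ w := by
  simp only [innerL2, mul_comm]

lemma innerH_comm (w φ : ℝ × ℝ → ℝ) : innerH X M w φ = innerH X M φ w := by
  simp only [innerH, innerL2_comm]

lemma innerH_self_nonneg (w : ℝ × ℝ → ℝ) : 0 ≤ innerH X M w w :=
  Finset.sum_nonneg fun _ _ => integral_nonneg fun _ => mul_self_nonneg _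

lemma normH_sq (w : ℝ × ℝ → ℝ) : normH X M w ^ 2 = innerH X M w w :=
  Real.sq_sqrt (innerH_self_nonneg w)

lemma innerL2_linComb (hw : MemLp w 2 (vol X)) (hw' : MemLp w' 2 (vol X))
    (hφ : MemLp φ 2 (vol X)) {k : ℝ × ℝ → ℝ} {a b : ℝ}
    (hk : k =ᵐ[vol X] fun p => a * w p + b * w' p) :
    innerL2 X k φ = a * innerL2 X w φ + b * innerL2 X w' φ := by
  unfold innerL2
  have i1 : Integrable (fun p => w p * φ p) (vol X) := hw.integrable_mul hφ
  have i2 : Integrable (fun p => w' p * φ p) (vol X) := hw'.integrable_mul hφ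
  rw [← integral_const_mul, ← integral_const_mul, ← integral_add (i1.const_mul _) (i2.const_mul _)]
  refine integral_congr_ae ?_
  filter_upwards [hk] with p hp
  rw [hp]; ring

lemma MemH1.linComb (hw : MemH1 X w) (hw' : MemH1 X w') (a b : ℝ) :
    MemH1 X (fun p => a * w p + b * w' p) :=
  .of_isL2Deriv (hw.dx.linComb hw'.dx a b) (hw.dv.linComb hw'.dv a b)

lemma opH_ae_eq {d d' : ℝ × ℝ → ℝ} (hx : Dx X w =ᵐ[vol X] d) (hv : Dv X w =ᵐ[vol X] d')
    (i : Fin 3) : opH X M w i =ᵐ[vol X]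
      (![w, fun p => sqrtMat M 0 0 * d p + sqrtMat M 0 1 * d' p,
        fun p => sqrtMat M 1 0 * d p + sqrtMat M 1 1 * d' p] : Fin 3 → ℝ × ℝ → ℝ) i := by
  filter_upwards [hx, hv] with p h1 h2
  fin_cases i <;> simp [opH, h1, h2]

lemma opH_linComb (hw : MemH1 X w) (hw' : MemH1 X w') (a b : ℝ) (i : Fin 3) :
    opH X M (fun p => a * w p + b * w' p) i =ᵐ[vol X]
      fun p => a * opH X M w i p + b * opH X M w' i p := by
  refine (opH_ae_eq (hw.dx.linComb hw'.dx a b).weakDeriv_ae_eq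
    (hw.dv.linComb hw'.dv a b).weakDeriv_ae_eq i).trans (Eventually.of_forall fun p => ?_)
  fin_cases i <;> simp [opH] <;> ring

lemma innerH_linComb (hw : MemH1 X w) (hw' : MemH1 X w') (hφ : MemH1 X φ) (a b : ℝ) :
    innerH X M (fun p => a * w p + b * w' p) φ = a * innerH X M w φ + b * innerH X M w' φ := by
  unfold innerH
  rw [Finset.mul_sum, Finset.mul_sum, ← Finset.sum_add_distrib]
  exact Finset.sum_congr rfl fun i _ =>
    innerL2_linComb (memLp_opH hw i) (memLp_opH hw' i) (memLp_opH hφ i) (opH_linComb hw hw' a b i)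

lemma innerH_self_eq (hM : M.PosSemidef) (hw : MemH1 X w) :
    innerH X M w w = innerL2 X w w + ∫ p, (M 0 0 * Dx X w p ^ 2 +
      (M 0 1 + M 1 0) * (Dx X w p * Dv X w p) + M 1 1 * Dv X w p ^ 2) ∂(vol X) := by
  obtain ⟨h00, h01, h11⟩ := sqrtMat_entries hM
  have hs := sqrtMat_symm M
  have hMs : M 1 0 = M 0 1 := by simpa using hM.1.apply 0 1
  have i1 : Integrable (fun p => opH X M w 1 p * opH X M w 1 p) (vol X) :=
    (memLp_opH hw 1).integrable_mul (memLp_opH hw 1)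
  have i2 : Integrable (fun p => opH X M w 2 p * opH X M w 2 p) (vol X) :=
    (memLp_opH hw 2).integrable_mul (memLp_opH hw 2)
  rw [innerH, Fin.sum_univ_three, add_assoc]
  congr 1
  unfold innerL2
  rw [← integral_add i1 i2]
  congr 1 with p
  simp only [opH, Matrix.cons_val_one, Matrix.cons_val_zero, Matrix.cons_val]
  rw [hMs, ← h00, ← h01, ← h11, hs]
  ring

lemma innerH_self_le (hM : M.PosSemidef) (hw : MemH1 X w) :
    innerH X M w w ≤ cEq M * (innerL2 X w w +
      (innerL2 X (Dx X w) (Dx X w) + innerL2 X (Dv X w) (Dv X w))) := by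
  have hx := hw.dx.memLp_deriv
  have hv := hw.dv.memLp_deriv
  have ix : Integrable (fun p => Dx X w p * Dx X w p) (vol X) := hx.integrable_mul hx
  have iv : Integrable (fun p => Dv X w p * Dv X w p) (vol X) := hv.integrable_mul hv
  have ixv : Integrable (fun p => Dx X w p * Dv X w p) (vol X) := hx.integrable_mul hv
  have h0 : 0 ≤ innerL2 X w w := integral_nonneg fun p => mul_self_nonneg _
  rw [innerH_self_eq hM hw, mul_add]
  refine add_le_add (le_mul_of_one_le_left h0 (le_max_left _ _)) ?_
  unfold innerL2
  rw [← integral_add ix iv, ← integral_const_mul]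
  refine integral_mono (((hx.integrable_sq.const_mul _).add (ixv.const_mul _)).add
    (hv.integrable_sq.const_mul _)) ((ix.add iv).const_mul _) fun p => ?_
  refine (le_lambdaMax_mul hM.1 (Dx X w p) (Dv X w p)).trans ?_
  rw [← pow_two, ← pow_two]
  exact mul_le_mul_of_nonneg_right (le_max_right _ _) (by positivity)

/-! ### The Poincaré inequality with the optimal constant -/

lemma innerL2_self_nonneg (w : ℝ × ℝ → ℝ) : 0 ≤ innerL2 X w w :=
  integral_nonneg fun _ => mul_self_nonneg _

lemma sqrt_innerL2_self_le_of_zeroTrace {Γ : Set (ℝ × ℝ)} (hΓ : MeasurableSet Γ) (hp : parabolic X ⊆ Γ)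
    (hw : MemH1 X w) (hz : ZeroTrace X Γ w) : Real.sqrt (innerL2 X w w) ≤
      8 * Real.sqrt (innerL2 X (Dx X w) (Dx X w) + innerL2 X (Dv X w) (Dv X w)) := by
  have h := poincare_of_zeroTrace hΓ hp hw hz
  have h1 := innerL2_self_nonneg (X := X) (Dx X w)
  have e : (8 : ℝ) = Real.sqrt 64 := by
    rw [show (64 : ℝ) = 8 ^ 2 by norm_num, Real.sqrt_sq (by norm_num)]
  rw [e, ← Real.sqrt_mul (by norm_num)]
  exact Real.sqrt_le_sqrt (by linarith)

/-- The infimum is itself admissible because the inequality is linear in `C`. The admissible set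
must be shown nonempty, since `sInf ∅ = 0`; the one-dimensional estimate in `v` supplies `C = 8`. -/
lemma innerL2_self_le_poincareConst (hw : MemH1 X w)
    (hz : ZeroTrace X (gammaMinus X) w ∨ ZeroTrace X (gammaPlus X) w) :
    innerL2 X w w ≤ poincareConst X ^ 2 *
      (innerL2 X (Dx X w) (Dx X w) + innerL2 X (Dv X w) (Dv X w)) := by
  set G := innerL2 X (Dx X w) (Dx X w) + innerL2 X (Dv X w) (Dv X w) with hG
  have hG0 : 0 ≤ G := add_nonneg (innerL2_self_nonneg _) (innerL2_self_nonneg _)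
  have key : Real.sqrt (innerL2 X w w) ≤ poincareConst X * Real.sqrt G := by
    have hne : {C : ℝ | 0 ≤ C ∧ ∀ w, MemH1 X w →
        (ZeroTrace X (gammaMinus X) w ∨ ZeroTrace X (gammaPlus X) w) →
        Real.sqrt (innerL2 X w w) ≤ C * Real.sqrt (innerL2 X (Dx X w) (Dx X w) +
          innerL2 X (Dv X w) (Dv X w))}.Nonempty :=
      ⟨8, by norm_num, fun w hw hz => hz.elim
        (sqrt_innerL2_self_le_of_zeroTrace (measurableSet_gammaMinus X) Set.subset_union_right hw)
        (sqrt_innerL2_self_le_of_zeroTrace (measurableSet_gammaPlus X) Set.subset_union_right hw)⟩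
    -- If `G = 0`, division is impossible, but any admissible `C` already forces `w` to have zero
    -- norm.
    rcases (Real.sqrt_nonneg G).eq_or_lt with h0 | hpos
    · obtain ⟨C, -, hC⟩ := hne
      have := hC w hw hz
      rw [← hG, ← h0, mul_zero] at this
      rwa [← h0, mul_zero]
    · rw [← div_le_iff₀ hpos]
      exact le_csInf hne fun C hC => (div_le_iff₀ hpos).2 (hC.2 w hw hz)
  have := pow_le_pow_left₀ (Real.sqrt_nonneg _) key 2
  rwa [mul_pow, Real.sq_sqrt (innerL2_self_nonneg w), Real.sq_sqrt hG0] at this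

/-! ### Coercivity -/

lemma delta_pos {ε : ℝ} (hε : 0 < ε) (hMN : M 1 1 ^ 2 < 4 * ε * M 0 1) : 0 < delta X ε M := by
  have h1 : 0 < cEq M := lt_of_lt_of_le one_pos (le_max_left _ _)
  have := lambdaMin_pos (posDef_matN hε hMN)
  unfold delta
  positivity

lemma delta_mul_innerH_le {ε : ℝ} (hε : 0 < ε) (hM : M.PosSemidef)
    (hMN : M 1 1 ^ 2 < 4 * ε * M 0 1) (hw : MemH1 X w)
    (hz : ZeroTrace X (gammaMinus X) w ∨ ZeroTrace X (gammaPlus X) w) :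
    delta X ε M * innerH X M w w ≤ lambdaMin (matN ε M) *
      (innerL2 X (Dx X w) (Dx X w) + innerL2 X (Dv X w) (Dv X w)) := by
  have h1 : 0 < cEq M := lt_of_lt_of_le one_pos (le_max_left _ _)
  have hl := lambdaMin_pos (posDef_matN hε hMN)
  have hP := innerL2_self_le_poincareConst hw hz
  set G := innerL2 X (Dx X w) (Dx X w) + innerL2 X (Dv X w) (Dv X w)
  have hle : innerH X M w w ≤ cEq M * ((1 + poincareConst X ^ 2) * G) :=
    (innerH_self_le hM hw).trans (mul_le_mul_of_nonneg_left (by linarith) h1.le)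
  calc delta X ε M * innerH X M w w
      ≤ delta X ε M * (cEq M * ((1 + poincareConst X ^ 2) * G)) :=
        mul_le_mul_of_nonneg_left hle (delta_pos hε hMN).le
    _ = lambdaMin (matN ε M) * G := by
        have : 1 + poincareConst X ^ 2 ≠ 0 := by positivity
        unfold delta
        field_simp

/-- Only the `L²` part of `‖w_v‖²_𝓗` is needed; the rest is nonnegative. The integrand is then the
quadratic form of `N`. -/
lemma lambdaMin_matN_mul_innerL2_le {ε : ℝ} (hε : 0 < ε) (hw : MemH1 X w) :
    lambdaMin (matN ε M) * (innerL2 X (Dx X w) (Dx X w) + innerL2 X (Dv X w) (Dv X w)) ≤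
      innerL2 X (fun p => M 0 1 * Dx X w p + M 1 1 * Dv X w p) (Dx X w) +
        ε * innerH X M (Dv X w) (Dv X w) := by
  have hx := hw.dx.memLp_deriv
  have hv := hw.dv.memLp_deriv
  have ix : Integrable (fun p => Dx X w p * Dx X w p) (vol X) := hx.integrable_mul hx
  have iv : Integrable (fun p => Dv X w p * Dv X w p) (vol X) := hv.integrable_mul hv
  have i3 : Integrable (fun p => (M 0 1 * Dx X w p + M 1 1 * Dv X w p) * Dx X w p) (vol X) :=
    (memLp_linComb hx hv _ _).integrable_mul hx
  have h1 : innerL2 X (Dv X w) (Dv X w) ≤ innerH X M (Dv X w) (Dv X w) := by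
    rw [innerH, Fin.sum_univ_three, add_assoc]
    exact le_add_of_nonneg_right (add_nonneg (innerL2_self_nonneg _) (innerL2_self_nonneg _))
  refine le_trans ?_ (add_le_add_right (mul_le_mul_of_nonneg_left h1 hε.le) _)
  unfold innerL2
  rw [← integral_add ix iv, ← integral_const_mul, ← integral_const_mul,
    ← integral_add i3 (iv.const_mul _)]
  refine integral_mono ((ix.add iv).const_mul _) (i3.add (iv.const_mul _)) fun p => ?_
  have := lambdaMin_matN_mul_le ε M (Dx X w p) (Dv X w p)
  simp only [pow_two] at this
  simp only
  linarith

lemma memH1_opH (hw : MemH2 X w) (i : Fin 3) : MemH1 X (opH X M w i) := by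
  fin_cases i
  · exact hw.1
  · exact hw.2.1.linComb hw.2.2 _ _
  · exact hw.2.1.linComb hw.2.2 _ _

lemma Dv_Dx_ae_eq (hw : MemH2 X w) : Dv X (Dx X w) =ᵐ[vol X] Dx X (Dv X w) :=
  (hw.1.dx.swap hw.1.dv hw.2.2.dx).weakDeriv_ae_eq

/-- `𝓗` commutes with `∂ₓ`. -/
lemma Dx_opH_ae_eq (hw : MemH2 X w) (i : Fin 3) :
    Dx X (opH X M w i) =ᵐ[vol X] opH X M (Dx X w) i := by
  have hcomm := Dv_Dx_ae_eq hw
  have h : ∀ a b : ℝ, Dx X (fun p => a * Dx X w p + b * Dv X w p) =ᵐ[vol X]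
      fun p => a * Dx X (Dx X w) p + b * Dv X (Dx X w) p := by
    intro a b
    refine (hw.2.1.dx.linComb hw.2.2.dx a b).weakDeriv_ae_eq.trans ?_
    filter_upwards [hcomm] with p hp
    rw [hp]
  fin_cases i
  · exact EventuallyEq.rfl
  · exact h _ _
  · exact h _ _

lemma innerL2_snd_mul_opH (hw : MemH2 X w) (i : Fin 3) :
    innerL2 X (fun p => p.2 * opH X M (Dx X w) i p) (opH X M w i) =
      ∫ p, p.2 * Dx X (opH X M w i) p * opH X M w i p ∂(vol X) := by
  refine integral_congr_ae ?_
  filter_upwards [Dx_opH_ae_eq hw i] with p hp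
  rw [hp]

/-- The gradient of `v w_x` is `v∇w_x + (0, w_x)`. The extra vector, paired with `∇w` through `M =
√M√M`, picks out the second row of `M` and gives the commutator term. -/
lemma formA_self_eq (hM : M.PosSemidef) (ε : ℝ) (hw : MemH2 X w) :
    formA X ε M w w =
      (∑ i, innerL2 X (fun p => p.2 * opH X M (Dx X w) i p) (opH X M w i)) +
      innerL2 X (fun p => M 0 1 * Dx X w p + M 1 1 * Dv X w p) (Dx X w) +
      ε * innerH X M (Dv X w) (Dv X w) := by
  obtain ⟨-, h01, h11⟩ := sqrtMat_entries hM
  have hs := sqrtMat_symm M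
  have m := fun i => memLp_opH (M := M) hw.1 i
  have mx := hw.1.dx.memLp_deriv
  have hdx : Dx X (fun p => p.2 * Dx X w p) =ᵐ[vol X] fun p => p.2 * Dx X (Dx X w) p := by
    refine hw.2.1.dx.snd_mul.weakDeriv_ae_eq.trans (Eventually.of_forall fun p => ?_)
    simp
  have hdv : Dv X (fun p => p.2 * Dx X w p) =ᵐ[vol X]
      fun p => Dx X w p + p.2 * Dv X (Dx X w) p := by
    refine hw.2.1.dv.snd_mul.weakDeriv_ae_eq.trans (Eventually.of_forall fun p => ?_)
    simp
  have mvx := fun i => memLp_snd_mul (memLp_opH (M := M) hw.2.1 i)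
  have c1 := innerL2_linComb (mvx 1) mx (m 1) (k := opH X M (fun p => p.2 * Dx X w p) 1)
    (a := 1) (b := sqrtMat M 0 1) (by
      filter_upwards [hdx, hdv] with p h1 h2
      simp only [opH, Matrix.cons_val_one, Matrix.cons_val_zero, h1, h2]
      ring)
  have c2 := innerL2_linComb (mvx 2) mx (m 2) (k := opH X M (fun p => p.2 * Dx X w p) 2)
    (a := 1) (b := sqrtMat M 1 1) (by
      filter_upwards [hdx, hdv] with p h1 h2
      simp only [opH, Matrix.cons_val, h1, h2]
      ring)
  have c3 := innerL2_linComb (m 1) (m 2) mx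
    (k := fun p => M 0 1 * Dx X w p + M 1 1 * Dv X w p)
    (a := sqrtMat M 0 1) (b := sqrtMat M 1 1) (Eventually.of_forall fun p => by
      simp only [opH, Matrix.cons_val_one, Matrix.cons_val_zero, Matrix.cons_val]
      rw [← h01, ← h11, hs]
      ring)
  have e1 := innerL2_comm (X := X) (Dx X w) (opH X M w 1)
  have e2 := innerL2_comm (X := X) (Dx X w) (opH X M w 2)
  rw [e1] at c1
  rw [e2] at c2
  rw [formA, innerH, Fin.sum_univ_three, Fin.sum_univ_three, c1, c2, c3]
  simp only [opH, Matrix.cons_val_zero]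
  ring

lemma formA_coercive {ε : ℝ} (hX : 0 < X) (hε : 0 < ε) (hM : M.PosSemidef)
    (hMN : M 1 1 ^ 2 < 4 * ε * M 0 1) (hw : w ∈ H2Zero X M (gammaMinus X)) :
    delta X ε M * innerH X M w w ≤ formA X ε M w w := by
  obtain ⟨h2, hz⟩ := hw
  have b1 := delta_mul_innerH_le hε hM hMN h2.1 (Or.inl (hz 0))
  have b2 := lambdaMin_matN_mul_innerL2_le (M := M) hε h2.1
  have b3 : 0 ≤ ∑ i, innerL2 X (fun p => p.2 * opH X M (Dx X w) i p) (opH X M w i) :=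
    Finset.sum_nonneg fun i _ => by
      rw [innerL2_snd_mul_opH h2 i]
      simpa only [one_mul] using transport_of_zeroTrace (σ := 1) (by simp)
        (fun φ hφ => transport_gammaMinus_of_contDiff hX hφ) (memH1_opH h2 i) (hz i)
  rw [formA_self_eq hM ε h2]
  linarith

/-- The transport term has the opposite sign here, matched by the vanishing trace on `Γ⁺`; the
commutator term is already part of the form. -/
lemma formAdj_coercive {ε : ℝ} (hX : 0 < X) (hε : 0 < ε) (hM : M.PosSemidef)
    (hMN : M 1 1 ^ 2 < 4 * ε * M 0 1) (hw : w ∈ H2Zero X M (gammaPlus X)) :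
    delta X ε M * innerH X M w w ≤ formAdj X ε M w w := by
  obtain ⟨h2, hz⟩ := hw
  have b1 := delta_mul_innerH_le hε hM hMN h2.1 (Or.inr (hz 0))
  have b2 := lambdaMin_matN_mul_innerL2_le (M := M) hε h2.1
  have b3 : ∑ i, innerL2 X (fun p => p.2 * opH X M (Dx X w) i p) (opH X M w i) ≤ 0 :=
    Finset.sum_nonpos fun i _ => by
      rw [innerL2_snd_mul_opH h2 i]
      have := transport_of_zeroTrace (σ := -1) (by simp)
        (fun φ hφ => transport_gammaPlus_of_contDiff hX hφ) (memH1_opH h2 i) (hz i)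
      linarith
  unfold formAdj
  linarith

end Kolmogorov

end

/-! ### The a priori estimate -/

theorem mainTheorem5 (xmax ε α : ℝ) (hx : 0 < xmax) (hε : 0 < ε) (hα : 0 < α)
    (M : Matrix (Fin 2) (Fin 2) ℝ) (hM : M.PosSemidef) (hM_entries : ∀ i j, 0 ≤ M i j)
    (hMN : (M 1 1) ^ 2 < 4 * ε * M 0 1)
    (D : ℝ × ℝ → ℝ) (hD : Kolmogorov.MemH1 xmax D) (u z f : ℝ × ℝ → ℝ)
    (h : Kolmogorov.SolvesKKT xmax ε α M D u z f) :
    0 < Kolmogorov.delta xmax ε M ∧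
      Kolmogorov.delta xmax ε M *
          (Kolmogorov.normH xmax M u ^ 2 + α / 2 * Kolmogorov.normH xmax M f ^ 2) ≤
        1 / (2 * α * Kolmogorov.delta xmax ε M) * Kolmogorov.normH xmax M D ^ 2 := by
  have hδ := Kolmogorov.delta_pos (X := xmax) hε hMN
  refine ⟨hδ, ?_⟩
  have hu : Kolmogorov.MemH1 xmax u := h.mem_u.1.1
  have hz : Kolmogorov.MemH1 xmax z := h.mem_z.1.1
  have hf := h.mem_f
  have cu := Kolmogorov.formA_coercive hx hε hM hMN h.mem_u
  have cz := Kolmogorov.formAdj_coercive hx hε hM hMN h.mem_z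
  rw [h.primal u h.mem_u] at cu
  have eD : (fun p => D p - u p) = fun p => 1 * D p + (-1) * u p := by funext p; ring
  rw [h.adjoint z h.mem_z, eD, Kolmogorov.innerH_linComb hD hu hz] at cz
  have hc : ∀ ξ, Kolmogorov.MemH1 xmax ξ →
      Kolmogorov.innerH xmax M z ξ = α * Kolmogorov.innerH xmax M f ξ := by
    intro ξ hξ
    have e : (fun p => α * f p - z p) = fun p => α * f p + (-1) * z p := by funext p; ring
    have := h.control ξ hξ
    rw [e, Kolmogorov.innerH_linComb hf hz hξ] at this
    linarith
  rw [hc z hz, Kolmogorov.innerH_comm f z, hc f hf, Kolmogorov.innerH_comm D z, hc D hD,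
    Kolmogorov.innerH_comm u z, hc u hu] at cz
  simp only [Kolmogorov.normH_sq]
  set δ := Kolmogorov.delta xmax ε M
  -- Young's inequality in the form `0 ≤ ‖D - αδ f‖²_𝓗`, with the weight that absorbs exactly half
  -- of `αδ‖f‖²_𝓗`.
  have hy := Kolmogorov.innerH_self_nonneg (X := xmax) (M := M)
    (fun p => 1 * D p + (-(α * δ)) * f p)
  rw [Kolmogorov.innerH_linComb hD hf (hD.linComb hf _ _), Kolmogorov.innerH_comm D,
    Kolmogorov.innerH_comm f, Kolmogorov.innerH_linComb hD hf hD,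
    Kolmogorov.innerH_linComb hD hf hf, Kolmogorov.innerH_comm D f] at hy
  set U := Kolmogorov.innerH xmax M u u
  set F := Kolmogorov.innerH xmax M f f
  set DD := Kolmogorov.innerH xmax M D D
  set fD := Kolmogorov.innerH xmax M f D
  set fu := Kolmogorov.innerH xmax M f u
  have cz' : δ * (α * F) ≤ fD - fu := by
    refine le_of_mul_le_mul_left ?_ hα
    linarith
  -- The terms `(f,u)_𝓗` from the state and adjoint equations cancel.
  have hsum : δ * (U + α * F) ≤ fD := by linarith
  rw [one_div_mul_eq_div, le_div_iff₀ (by positivity)]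
  have := mul_le_mul_of_nonneg_left hsum (show 0 ≤ 2 * α * δ by positivity)
  nlinarith
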